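/- Let $d\ge 1$. For a measurable $p:\mathbb{R}^d\to[0,\infty]$, a unit vector $v\in S^{d-1}$ and $t\in\mathbb{R}$ let $$R_vp(t)=\int_{v^\perp}p(tv+y)\,dy$$ be the Radon transform of $p$ (integration with respect to $(d-1)$-dimensional Lebesgue measure on the hyperplane $v^\perp$). For probability measures $\mu,\nu$ on $\mathbb{R}$ let $$W^2(\mu,\nu)=\inf_{\pi}\int_{\mathbb{R}\times\mathbb{R}}|x-y|^2\,d\pi(x,y)\in[0,\infty],$$ the infimum being over all couplings $\pi$ of $\mu$ and $\nu$. For probability measures $P,Q$ on $\mathbb{R}^d$ with Lebesgue densities $p,q$, the squared sliced Wasserstein distance is $$SW^2(P,Q)=\int_{S^{d-1}}W^2\big(R_vp(t)\,dt,\;R_vq(t)\,dt\big)\,dv\in[0,\infty],$$ where $dv$ is surface measure on the unit sphere. Then $SW^2(P,Q)<\infty$ whenever $P$ and $Q$ are probability measures with Lebesgue densities and finite second moments. Moreover, let $\mathbb{S}$ be any set of probability measures on $\mathbb{R}^d$ with Lebesgue densities such that $SW^2(P,Q)<\infty$ for all $P,Q\in\mathbb{S}$ (for example, all those with finite second moment).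 Then $SW^2:\mathbb{S}\times\mathbb{S}\to\mathbb{R}$ is a conditionally negative definite kernel: it is symmetric, and for every $N$, all $P_1,\dots,P_N\in\mathbb{S}$ and all real $a_1,\dots,a_N$ with $\sum_{i=1}^N a_i=0$, $$\sum_{i=1}^N\sum_{j=1}^N a_ia_j\,SW^2(P_i,P_j)\le 0.$$ -/

import Mathlib

open MeasureTheory
open scoped ENNReal

/-- A kernel `k : S × S → ℝ` is conditionally negative definite if it is symmetric and
`∑ i, ∑ j, a i * a j * k (s i) (s j) ≤ 0` for all finite families of points `s i` (repetitions
allowed) and of real weights `a i` with `∑ i, a i = 0`. -/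
def IsCondNegDefKernel {S : Type*} (k : S → S → ℝ) : Prop :=
  (∀ s t : S, k s t = k t s) ∧
    ∀ (N : ℕ) (s : Fin N → S) (a : Fin N → ℝ), ∑ i, a i = 0 →
      ∑ i, ∑ j, a i * a j * k (s i) (s j) ≤ 0

/-- `p` is a probability density function of the probability measure `P` on `ℝ^d`
with respect to Lebesgue measure. -/
def IsDensity {d : ℕ} (P : ProbabilityMeasure (EuclideanSpace ℝ (Fin d)))
    (p : EuclideanSpace ℝ (Fin d) → ℝ≥0∞) : Prop :=
  Measurable p ∧ (P : Measure (EuclideanSpace ℝ (Fin d))) = volume.withDensity p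

/-- The squared `L²` Wasserstein distance between two measures on the line: the infimum of
`∫ |x - y|² dπ(x, y)` over all couplings `π`, i.e. measures on `ℝ × ℝ` with marginals
`μ` and `ν`. -/
noncomputable def wassersteinSq (μ ν : Measure ℝ) : ℝ≥0∞ :=
  ⨅ (π : Measure (ℝ × ℝ)) (_ : π.map Prod.fst = μ ∧ π.map Prod.snd = ν),
    ∫⁻ z, ENNReal.ofReal ((z.1 - z.2) ^ 2) ∂π

/-- The Radon transform of `p` in the direction `v` (a unit vector) at offset `t`: the integral
of `p` over the hyperplane `{x | ⟪x, v⟫ = t} = t • v + v^⊥`, with respect to the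
`(d - 1)`-dimensional Lebesgue measure on the Euclidean space `v^⊥`. -/
noncomputable def radon {d : ℕ} (p : EuclideanSpace ℝ (Fin d) → ℝ≥0∞)
    (v : EuclideanSpace ℝ (Fin d)) (t : ℝ) : ℝ≥0∞ :=
  ∫⁻ y : (Submodule.span ℝ {v})ᗮ, p (t • v + (y : EuclideanSpace ℝ (Fin d)))

/-- The squared sliced Wasserstein distance between the probability measures with densities
`p` and `q`: the integral over the unit sphere, with respect to surface measure, of the squared
one-dimensional Wasserstein distance between the measures on `ℝ` whose densities are the
Radon transforms of `p` and `q` in the direction `v`. -/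
noncomputable def slicedWassersteinSq {d : ℕ}
    (p q : EuclideanSpace ℝ (Fin d) → ℝ≥0∞) : ℝ≥0∞ :=
  ∫⁻ v : Metric.sphere (0 : EuclideanSpace ℝ (Fin d)) 1,
    wassersteinSq (volume.withDensity (radon p v)) (volume.withDensity (radon q v))
    ∂(volume : Measure (EuclideanSpace ℝ (Fin d))).toSphere

/-!
The squared sliced Wasserstein distance is a squared `L²` distance between functions attached to
the measures, and a squared Hilbertian distance is conditionally negative definite: if
`∑ i, a i = 0`, then `∑ i, ∑ j, a i * a j * (x i - x j) ^ 2 = -2 * (∑ i, a i * x i) ^ 2`.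

To a measure `P` one attaches the function `(v, u) ↦ quantile (sliceLaw P v) u` on the product of
the sphere and `(0, 1)`, where `sliceLaw P v` is the law of `⟪v, x⟫` under `P`. By Fubini along
`ℝ v ⊕ v^⊥`, this law has the Radon transform of the density of `P` as its density
(`withDensity_radon`). On the line, the squared Wasserstein distance equals the squared `L²`
distance of the quantile functions (`wassersteinSq_eq_lintegral_quantile`). Since no moments are
assumed there, optimality of the monotone coupling is proved from a layer cake formula: `(x - y)²`
is the area of a square, so the cost of a coupling is an integral over pairs of thresholds
`m ≤ M` of the probabilities of `{y ≤ m, M < x}` and `{x ≤ m, M < y}`. Such a probability is at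
least the truncated difference of the marginal distribution functions at `m` and `M`, with equality
for the monotone coupling.

The functions attached to the measures need not be square integrable, but their differences are
whenever the distance is finite, which suffices to integrate the pointwise identity
(`sum_sum_mul_lintegral_sub_sq_nonpos`). This uses joint measurability of the quantiles in the
direction and the level (`measurable_quantile_prod`). Finiteness under second moments follows by
testing the independent coupling in each slice.
-/

open ProbabilityTheory Set

/-! ### Quantile functions -/

/-- The quantile function `u ↦ inf {x | u ≤ F x}` of a probability measure on the line with
distribution function `F`. It is set to `0` outside `(0, 1)`, which makes it measurable on all
of `ℝ`. -/
noncomputable def quantile (μ : Measure ℝ) : ℝ → ℝ :=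
  (Ioo 0 1).indicator fun u => sInf {x | u ≤ cdf μ x}

/-- The quantile function and the distribution function form a Galois connection on `(0, 1)`. -/
theorem quantile_le_iff (μ : Measure ℝ) {u : ℝ} (hu : u ∈ Ioo (0 : ℝ) 1) (x : ℝ) :
    quantile μ u ≤ x ↔ u ≤ cdf μ x := by
  rw [quantile, indicator_of_mem hu]
  have hne : {x | u ≤ cdf μ x}.Nonempty :=
    ((tendsto_cdf_atTop μ).eventually (eventually_ge_nhds hu.2)).exists
  have hbdd : BddBelow {x | u ≤ cdf μ x} := by
    obtain ⟨b, hb⟩ := ((tendsto_cdf_atBot μ).eventually (eventually_lt_nhds hu.1)).exists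
    refine ⟨b, fun y hy => ?_⟩
    by_contra! hyb
    exact absurd (hy.trans (monotone_cdf μ hyb.le)) (not_le.2 hb)
  refine ⟨fun h => ?_, fun h => csInf_le hbdd h⟩
  -- right continuity of the distribution function: the infimum is attained
  have hright : ∀ y, x < y → u ≤ cdf μ y := fun y hy => by
    obtain ⟨z, hz, hzy⟩ := exists_lt_of_csInf_lt hne (h.trans_lt hy)
    exact le_trans hz (monotone_cdf μ hzy.le)
  have hlim : Filter.Tendsto (cdf μ) (nhdsWithin x (Ioi x)) (nhds (cdf μ x)) :=
    ((cdf μ).right_continuous x).mono_left (nhdsWithin_mono x Ioi_subset_Ici_self)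
  exact ge_of_tendsto hlim (Filter.eventually_of_mem self_mem_nhdsWithin hright)

/-- Quantile functions of a measurable family of probability measures are jointly measurable in
the parameter and the level. -/
theorem measurable_quantile_prod {V : Type*} [MeasurableSpace V] {κ : V → Measure ℝ}
    [∀ v, IsProbabilityMeasure (κ v)] (hκ : Measurable κ) :
    Measurable fun z : V × ℝ => quantile (κ z.1) z.2 := by
  refine measurable_of_Iic fun x => ?_
  have hcdf : Measurable fun v => cdf (κ v) x := by
    simp_rw [cdf_eq_real]
    exact ((Measure.measurable_coe measurableSet_Iic).comp hκ).ennreal_toReal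
  have hset : (fun z : V × ℝ => quantile (κ z.1) z.2) ⁻¹' Iic x =
      ({z | z.2 ∈ Ioo (0 : ℝ) 1} ∩ {z | z.2 ≤ cdf (κ z.1) x}) ∪
        ({z | z.2 ∈ Ioo (0 : ℝ) 1}ᶜ ∩ {_z | 0 ≤ x}) := by
    ext z
    by_cases hz : z.2 ∈ Ioo (0 : ℝ) 1
    · simp only [mem_preimage, mem_Iic, quantile_le_iff _ hz, mem_union, mem_inter_iff,
        mem_ofPred_eq, mem_compl_iff, hz, true_and, not_true, false_and, or_false]
    · simp only [mem_preimage, mem_Iic, quantile, indicator_of_notMem hz, mem_union, mem_inter_iff,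
        mem_ofPred_eq, mem_compl_iff, hz, false_and, not_false_eq_true, true_and, false_or]
  rw [hset]
  have h₁ : MeasurableSet {z : V × ℝ | z.2 ∈ Ioo (0 : ℝ) 1} := measurable_snd measurableSet_Ioo
  exact (h₁.inter (measurableSet_le measurable_snd (hcdf.comp measurable_fst))).union
    (h₁.compl.inter (MeasurableSet.const _))

theorem measurable_quantile (μ : Measure ℝ) [IsProbabilityMeasure μ] : Measurable (quantile μ) :=
  (measurable_quantile_prod (κ := fun _ : Unit => μ) measurable_const).comp
    (measurable_const (a := ()) |>.prodMk measurable_id)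

/-- The quantile function transports the uniform distribution on `(0, 1)` to the measure. -/
theorem map_quantile (μ : Measure ℝ) [IsProbabilityMeasure μ] :
    (volume.restrict (Ioo (0 : ℝ) 1)).map (quantile μ) = μ := by
  have : IsFiniteMeasure ((volume.restrict (Ioo (0 : ℝ) 1)).map (quantile μ)) := inferInstance
  refine Measure.ext_of_Iic _ _ fun x => ?_
  rw [Measure.map_apply (measurable_quantile μ) measurableSet_Iic,
    Measure.restrict_apply (measurable_quantile μ measurableSet_Iic), ← ofReal_cdf μ x]
  have hset : quantile μ ⁻¹' Iic x ∩ Ioo 0 1 = Iic (cdf μ x) ∩ Ioo 0 1 := by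
    ext u
    simp only [mem_inter_iff, mem_preimage, mem_Iic]
    exact and_congr_left fun hu => quantile_le_iff μ hu x
  rw [hset]
  refine le_antisymm ?_ ?_
  · refine (measure_mono (t := Ioc 0 (cdf μ x)) fun u hu => ⟨hu.2.1, hu.1⟩).trans ?_
    simp
  · refine le_trans ?_ (measure_mono (s := Ioo 0 (cdf μ x)) fun u hu =>
      ⟨hu.2.le, hu.1, hu.2.trans_le (cdf_le_one μ x)⟩)
    simp

/-! ### Optimality of the monotone coupling on the line -/

/-- The square `(x - y)²` is the area of the square with side `[y, x)` or `[x, y)`. -/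
theorem ofReal_sub_sq_eq_volume (x y : ℝ) :
    ENNReal.ofReal ((x - y) ^ 2) =
      volume {w : ℝ × ℝ | y ≤ min w.1 w.2 ∧ max w.1 w.2 < x} +
        volume {w : ℝ × ℝ | x ≤ min w.1 w.2 ∧ max w.1 w.2 < y} := by
  have h : ∀ a b : ℝ, {w : ℝ × ℝ | b ≤ min w.1 w.2 ∧ max w.1 w.2 < a} = Ico b a ×ˢ Ico b a := by
    intro a b
    ext w
    simp only [mem_ofPred_eq, le_min_iff, max_lt_iff, mem_prod, mem_Ico]
    tauto
  rw [h, h, Measure.volume_eq_prod, Measure.prod_prod, Measure.prod_prod, Real.volume_Ico,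
    Real.volume_Ico]
  rcases le_total x y with hxy | hxy
  · rw [ENNReal.ofReal_of_nonpos (sub_nonpos.2 hxy), zero_mul, zero_add,
      ← ENNReal.ofReal_mul (sub_nonneg.2 hxy)]
    congr 1
    ring
  · rw [ENNReal.ofReal_of_nonpos (sub_nonpos.2 hxy), zero_mul, add_zero,
      ← ENNReal.ofReal_mul (sub_nonneg.2 hxy)]
    congr 1
    ring

theorem measurableSet_le_and_lt {α : Type*} [MeasurableSpace α] {f g a b : α → ℝ}
    (hf : Measurable f) (hg : Measurable g) (ha : Measurable a) (hb : Measurable b) :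
    MeasurableSet {z | f z ≤ a z ∧ b z < g z} :=
  (measurableSet_le hf ha).inter (measurableSet_lt hb hg)

/-- The transport cost of a coupling as an integral over pairs `w` of thresholds: only the
probabilities that one coordinate is at most both thresholds and the other one exceeds both
enter. -/
theorem lintegral_sub_sq_eq (π : Measure (ℝ × ℝ)) [SFinite π] :
    ∫⁻ z, ENNReal.ofReal ((z.1 - z.2) ^ 2) ∂π =
      ∫⁻ w : ℝ × ℝ, (π {z | z.2 ≤ min w.1 w.2 ∧ max w.1 w.2 < z.1} +
        π {z | z.1 ≤ min w.1 w.2 ∧ max w.1 w.2 < z.2}) := by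
  have h₁ : MeasurableSet {q : (ℝ × ℝ) × (ℝ × ℝ) |
      q.1.2 ≤ min q.2.1 q.2.2 ∧ max q.2.1 q.2.2 < q.1.1} :=
    measurableSet_le_and_lt (measurable_snd.comp measurable_fst)
      (measurable_fst.comp measurable_fst) (by fun_prop) (by fun_prop)
  have h₂ : MeasurableSet {q : (ℝ × ℝ) × (ℝ × ℝ) |
      q.1.1 ≤ min q.2.1 q.2.2 ∧ max q.2.1 q.2.2 < q.1.2} :=
    measurableSet_le_and_lt (measurable_fst.comp measurable_fst)
      (measurable_snd.comp measurable_fst) (by fun_prop) (by fun_prop)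
  simp_rw [ofReal_sub_sq_eq_volume]
  refine (lintegral_add_left (measurable_measure_prodMk_left (ν := volume) h₁) _).trans
    (Eq.trans ?_ (lintegral_add_left (measurable_measure_prodMk_right (μ := π) h₁) _).symm)
  exact congrArg₂ (· + ·)
    ((Measure.prod_apply (ν := volume) h₁).symm.trans (Measure.prod_apply_symm h₁))
    ((Measure.prod_apply (ν := volume) h₂).symm.trans (Measure.prod_apply_symm h₂))

/-- The monotone coupling of `μ` and `ν`: the joint law of the two quantile functions under the
uniform distribution on `(0, 1)`. -/
noncomputable def monotoneCoupling (μ ν : Measure ℝ) : Measure (ℝ × ℝ) :=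
  (volume.restrict (Ioo (0 : ℝ) 1)).map fun u => (quantile μ u, quantile ν u)

/-- Under the monotone coupling, the probability that one coordinate is at most `m` while the other
one exceeds `M` is at most `ν (Iic m) - μ (Iic M)`, a lower bound for every coupling. -/
theorem volume_quantile_le_lt (μ ν : Measure ℝ) [IsProbabilityMeasure μ] [IsProbabilityMeasure ν]
    (m M : ℝ) :
    volume.restrict (Ioo (0 : ℝ) 1) {u | quantile ν u ≤ m ∧ M < quantile μ u} ≤
      ν (Iic m) - μ (Iic M) := by
  rw [Measure.restrict_apply' measurableSet_Ioo, ← ofReal_cdf, ← ofReal_cdf,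
    ← ENNReal.ofReal_sub _ (cdf_nonneg μ M), ← Real.volume_Ioc]
  refine measure_mono ?_
  rintro u ⟨⟨hu₁, hu₂⟩, hu⟩
  exact ⟨not_le.1 fun h => not_lt.2 ((quantile_le_iff μ hu M).2 h) hu₂,
    (quantile_le_iff ν hu m).1 hu₁⟩

/-- The squared Wasserstein distance on the line is the squared `L²` distance of the quantile
functions. Optimality of the monotone coupling is checked threshold by threshold, so no moment
assumption is needed and both sides may be infinite. -/
theorem wassersteinSq_eq_lintegral_quantile (μ ν : Measure ℝ) [IsProbabilityMeasure μ]
    [IsProbabilityMeasure ν] :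
    wassersteinSq μ ν =
      ∫⁻ u in Ioo (0 : ℝ) 1, ENNReal.ofReal ((quantile μ u - quantile ν u) ^ 2) := by
  have hmeas : Measurable fun u => (quantile μ u, quantile ν u) :=
    (measurable_quantile μ).prodMk (measurable_quantile ν)
  have hcost : ∫⁻ z, ENNReal.ofReal ((z.1 - z.2) ^ 2) ∂monotoneCoupling μ ν =
      ∫⁻ u in Ioo (0 : ℝ) 1, ENNReal.ofReal ((quantile μ u - quantile ν u) ^ 2) :=
    lintegral_map (by fun_prop) hmeas
  have hle : ∀ m M : ℝ, ∀ f g : ℝ × ℝ → ℝ, Measurable f → Measurable g →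
      MeasurableSet {z | f z ≤ m ∧ M < g z} := fun m M f g hf hg =>
    measurableSet_le_and_lt hf hg measurable_const measurable_const
  rw [← hcost]
  have hcoupling : (monotoneCoupling μ ν).map Prod.fst = μ ∧
      (monotoneCoupling μ ν).map Prod.snd = ν := by
    rw [monotoneCoupling, Measure.map_map measurable_fst hmeas,
      Measure.map_map measurable_snd hmeas]
    exact ⟨map_quantile μ, map_quantile ν⟩
  refine le_antisymm (iInf₂_le (monotoneCoupling μ ν) hcoupling) (le_iInf₂ fun π hπ => ?_)
  obtain ⟨hfst, hsnd⟩ := hπ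
  have : IsProbabilityMeasure (π.map Prod.fst) := hfst ▸ inferInstance
  have : IsProbabilityMeasure π := Measure.isProbabilityMeasure_of_map Prod.fst
  have : IsFiniteMeasure (monotoneCoupling μ ν) := by
    unfold monotoneCoupling; infer_instance
  rw [lintegral_sub_sq_eq, lintegral_sub_sq_eq]
  refine lintegral_mono fun w => add_le_add ?_ ?_
  -- `ν (Iic m) - μ (Iic M) ≤ π ({z.2 ≤ m} \ {z.1 ≤ M})` for every coupling `π`
  · rw [monotoneCoupling, Measure.map_apply hmeas (hle _ _ _ _ measurable_snd measurable_fst)]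
    refine (volume_quantile_le_lt μ ν _ _).trans ?_
    rw [← hfst, ← hsnd, Measure.map_apply measurable_snd measurableSet_Iic,
      Measure.map_apply measurable_fst measurableSet_Iic]
    exact le_measure_sdiff.trans (measure_mono fun z hz => ⟨hz.1, not_le.1 hz.2⟩)
  · rw [monotoneCoupling, Measure.map_apply hmeas (hle _ _ _ _ measurable_fst measurable_snd)]
    refine (volume_quantile_le_lt ν μ _ _).trans ?_
    rw [← hfst, ← hsnd, Measure.map_apply measurable_snd measurableSet_Iic,
      Measure.map_apply measurable_fst measurableSet_Iic]
    exact le_measure_sdiff.trans (measure_mono fun z hz => ⟨hz.1, not_le.1 hz.2⟩)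

/-- Testing the independent coupling bounds the Wasserstein distance by second moments. -/
theorem wassersteinSq_le (μ ν : Measure ℝ) [IsProbabilityMeasure μ] [IsProbabilityMeasure ν] :
    wassersteinSq μ ν ≤
      2 * ∫⁻ x, ENNReal.ofReal (x ^ 2) ∂μ + 2 * ∫⁻ y, ENNReal.ofReal (y ^ 2) ∂ν := by
  have hcoupling : (μ.prod ν).map Prod.fst = μ ∧ (μ.prod ν).map Prod.snd = ν := by
    rw [Measure.map_fst_prod, Measure.map_snd_prod, measure_univ, measure_univ, one_smul, one_smul]
    exact ⟨rfl, rfl⟩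
  refine (iInf₂_le (μ.prod ν) hcoupling).trans ?_
  calc ∫⁻ z, ENNReal.ofReal ((z.1 - z.2) ^ 2) ∂(μ.prod ν)
    _ ≤ ∫⁻ z, (2 * ENNReal.ofReal (z.1 ^ 2) + 2 * ENNReal.ofReal (z.2 ^ 2)) ∂(μ.prod ν) := by
      refine lintegral_mono fun z => ?_
      rw [← mul_add, ← ENNReal.ofReal_add (sq_nonneg _) (sq_nonneg _),
        ← ENNReal.ofReal_ofNat 2, ← ENNReal.ofReal_mul zero_le_two]
      exact ENNReal.ofReal_le_ofReal (by nlinarith [sq_nonneg (z.1 + z.2)])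
    _ = _ := by
      rw [lintegral_add_left (by fun_prop), lintegral_const_mul _ (by fun_prop),
        lintegral_const_mul _ (by fun_prop)]
      congr 2
      · exact (measurePreserving_fst (μ := μ) (ν := ν)).lintegral_comp
          (f := fun x => ENNReal.ofReal (x ^ 2)) (by fun_prop)
      · exact (measurePreserving_snd (μ := μ) (ν := ν)).lintegral_comp
          (f := fun x => ENNReal.ofReal (x ^ 2)) (by fun_prop)

/-! ### The Radon transform as a density of the projection -/

/-- Splitting off the coordinate along a unit vector preserves Lebesgue measure. -/
theorem measurePreserving_smul_add_orthogonal {d : ℕ} {v : EuclideanSpace ℝ (Fin d)}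
    (hv : ‖v‖ = 1) :
    MeasurePreserving fun z : ℝ × (Submodule.span ℝ {v})ᗮ =>
      z.1 • v + (z.2 : EuclideanSpace ℝ (Fin d)) := by
  have h₁ := ((LinearIsometryEquiv.toSpanUnitSingleton (𝕜 := ℝ) v hv).measurePreserving).prod
    (MeasurePreserving.id (volume : Measure (Submodule.span ℝ {v})ᗮ))
  have h₂ := (Submodule.span ℝ {v}).orthogonalDecomposition.symm.measurePreserving.comp
    ((WithLp.volume_preserving_toLp _ _).comp h₁)
  -- the composition is definitionally `(t, y) ↦ t • v + y`
  exact h₂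

/-- The Radon transform in a unit direction is a density of the law of the projection to that
direction. -/
theorem withDensity_radon {d : ℕ} {p : EuclideanSpace ℝ (Fin d) → ℝ≥0∞} (hp : Measurable p)
    {v : EuclideanSpace ℝ (Fin d)} (hv : ‖v‖ = 1) :
    volume.withDensity (radon p v) = (volume.withDensity p).map fun x => inner ℝ v x := by
  have hinner : Measurable fun x : EuclideanSpace ℝ (Fin d) => inner ℝ v x := by fun_prop
  have he := measurePreserving_smul_add_orthogonal hv
  ext s hs
  rw [Measure.map_apply hinner hs, withDensity_apply _ hs, withDensity_apply _ (hinner hs),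
    ← he.setLIntegral_comp_preimage (hinner hs) hp]
  have hset : (fun z : ℝ × (Submodule.span ℝ {v})ᗮ =>
      z.1 • v + (z.2 : EuclideanSpace ℝ (Fin d))) ⁻¹' ((fun x => inner ℝ v x) ⁻¹' s) =
        s ×ˢ univ := by
    ext z
    have hz : inner ℝ v (z.2 : EuclideanSpace ℝ (Fin d)) = 0 :=
      Submodule.mem_orthogonal_singleton_iff_inner_right.1 z.2.2
    simp [inner_add_right, inner_smul_right, hz, hv]
  rw [hset, Measure.volume_eq_prod, setLIntegral_prod]
  · simp only [Measure.restrict_univ]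
    rfl
  · exact (hp.comp he.measurable).aemeasurable

/-! ### Sliced Wasserstein distance as a squared `L²` distance -/

/-- The law of the projection of `P` to the direction `v`. -/
noncomputable def sliceLaw {d : ℕ} (P : Measure (EuclideanSpace ℝ (Fin d)))
    (v : Metric.sphere (0 : EuclideanSpace ℝ (Fin d)) 1) : Measure ℝ :=
  P.map fun x => inner ℝ (v : EuclideanSpace ℝ (Fin d)) x

instance {d : ℕ} (P : Measure (EuclideanSpace ℝ (Fin d))) [IsProbabilityMeasure P]
    (v : Metric.sphere (0 : EuclideanSpace ℝ (Fin d)) 1) : IsProbabilityMeasure (sliceLaw P v) :=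
  Measure.isProbabilityMeasure_map (by fun_prop)

theorem measurable_sliceLaw {d : ℕ} (P : Measure (EuclideanSpace ℝ (Fin d)))
    [IsProbabilityMeasure P] : Measurable (sliceLaw P) := by
  refine Measure.measurable_of_measurable_coe _ fun s hs => ?_
  have h : Measurable fun z : Metric.sphere (0 : EuclideanSpace ℝ (Fin d)) 1 ×
      EuclideanSpace ℝ (Fin d) => inner ℝ (z.1 : EuclideanSpace ℝ (Fin d)) z.2 := by fun_prop
  have heq : ∀ v, sliceLaw P v s = P (Prod.mk v ⁻¹'
      ((fun z : Metric.sphere (0 : EuclideanSpace ℝ (Fin d)) 1 × EuclideanSpace ℝ (Fin d) =>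
        inner ℝ (z.1 : EuclideanSpace ℝ (Fin d)) z.2) ⁻¹' s)) :=
    fun v => Measure.map_apply (by fun_prop) hs
  simp_rw [heq]
  exact measurable_measure_prodMk_left (h hs)

theorem measurable_quantile_sliceLaw {d : ℕ} (P : Measure (EuclideanSpace ℝ (Fin d)))
    [IsProbabilityMeasure P] :
    Measurable fun z : Metric.sphere (0 : EuclideanSpace ℝ (Fin d)) 1 × ℝ =>
      quantile (sliceLaw P z.1) z.2 :=
  measurable_quantile_prod (measurable_sliceLaw P)

theorem slicedWassersteinSq_eq_lintegral_sliceLaw {d : ℕ}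
    {P Q : ProbabilityMeasure (EuclideanSpace ℝ (Fin d))}
    {p q : EuclideanSpace ℝ (Fin d) → ℝ≥0∞} (hp : IsDensity P p) (hq : IsDensity Q q) :
    slicedWassersteinSq p q =
      ∫⁻ v, wassersteinSq (sliceLaw P v) (sliceLaw Q v)
        ∂(volume : Measure (EuclideanSpace ℝ (Fin d))).toSphere := by
  refine lintegral_congr fun v => ?_
  have hv : ‖(v : EuclideanSpace ℝ (Fin d))‖ = 1 := by simp
  rw [withDensity_radon hp.1 hv, withDensity_radon hq.1 hv, ← hp.2, ← hq.2, sliceLaw, sliceLaw]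

/-- The squared sliced Wasserstein distance is the squared distance of the slicewise quantile
functions in `L²` of the sphere times the unit interval. -/
theorem slicedWassersteinSq_eq_lintegral_quantile {d : ℕ}
    {P Q : ProbabilityMeasure (EuclideanSpace ℝ (Fin d))}
    {p q : EuclideanSpace ℝ (Fin d) → ℝ≥0∞} (hp : IsDensity P p) (hq : IsDensity Q q) :
    slicedWassersteinSq p q =
      ∫⁻ z, ENNReal.ofReal ((quantile (sliceLaw P z.1) z.2 - quantile (sliceLaw Q z.1) z.2) ^ 2)
        ∂((volume : Measure (EuclideanSpace ℝ (Fin d))).toSphere.prod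
          (volume.restrict (Ioo (0 : ℝ) 1))) := by
  rw [slicedWassersteinSq_eq_lintegral_sliceLaw hp hq, lintegral_prod]
  · exact lintegral_congr fun v => wassersteinSq_eq_lintegral_quantile _ _
  · exact (((measurable_quantile_sliceLaw _).sub (measurable_quantile_sliceLaw _)).pow_const
      2).ennreal_ofReal.aemeasurable

/-- By Cauchy–Schwarz, projecting to a unit direction does not increase the second moment. -/
theorem lintegral_sq_sliceLaw_le {d : ℕ} (P : Measure (EuclideanSpace ℝ (Fin d)))
    (v : Metric.sphere (0 : EuclideanSpace ℝ (Fin d)) 1) :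
    ∫⁻ t, ENNReal.ofReal (t ^ 2) ∂sliceLaw P v ≤ ∫⁻ x, ‖x‖ₑ ^ 2 ∂P := by
  rw [sliceLaw, lintegral_map (by fun_prop) (by fun_prop)]
  refine lintegral_mono fun x => ?_
  have hv : ‖(v : EuclideanSpace ℝ (Fin d))‖ = 1 := by simp
  have h := abs_real_inner_le_norm (v : EuclideanSpace ℝ (Fin d)) x
  rw [hv, one_mul] at h
  rw [← ofReal_norm, ← ENNReal.ofReal_pow (norm_nonneg x)]
  exact ENNReal.ofReal_le_ofReal (sq_le_sq.2 (by rwa [abs_norm]))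

theorem slicedWassersteinSq_lt_top {d : ℕ} {P Q : ProbabilityMeasure (EuclideanSpace ℝ (Fin d))}
    {p q : EuclideanSpace ℝ (Fin d) → ℝ≥0∞} (hp : IsDensity P p) (hq : IsDensity Q q)
    (hP : MemLp id 2 (P : Measure (EuclideanSpace ℝ (Fin d))))
    (hQ : MemLp id 2 (Q : Measure (EuclideanSpace ℝ (Fin d)))) :
    slicedWassersteinSq p q < ∞ := by
  have hfin : ∀ ρ : Measure (EuclideanSpace ℝ (Fin d)), MemLp id 2 ρ →
      ∫⁻ x, ‖x‖ₑ ^ 2 ∂ρ < ∞ := fun ρ hρ => by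
    simpa using lintegral_rpow_enorm_lt_top_of_eLpNorm_lt_top two_ne_zero ENNReal.ofNat_ne_top
      hρ.2
  rw [slicedWassersteinSq_eq_lintegral_sliceLaw hp hq]
  refine (lintegral_mono fun v => (wassersteinSq_le _ _).trans (add_le_add
    (mul_le_mul_right (lintegral_sq_sliceLaw_le _ v) 2)
    (mul_le_mul_right (lintegral_sq_sliceLaw_le _ v) 2))).trans_lt ?_
  rw [lintegral_const]
  exact ENNReal.mul_lt_top (ENNReal.add_lt_top.2
    ⟨ENNReal.mul_lt_top ENNReal.ofNat_lt_top (hfin _ hP),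
      ENNReal.mul_lt_top ENNReal.ofNat_lt_top (hfin _ hQ)⟩) (measure_lt_top _ _)

/-! ### Conditional negative definiteness -/

theorem sum_sum_mul_sub_sq {ι : Type*} [Fintype ι] (a x : ι → ℝ) (ha : ∑ i, a i = 0) :
    ∑ i, ∑ j, a i * a j * (x i - x j) ^ 2 = -2 * (∑ i, a i * x i) ^ 2 := by
  have h : ∀ i, ∑ j, a i * a j * (x i - x j) ^ 2 =
      a i * x i ^ 2 * ∑ j, a j - 2 * (a i * x i) * ∑ j, a j * x j +
        a i * ∑ j, a j * x j ^ 2 := fun i => by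
    rw [Finset.mul_sum, Finset.mul_sum, Finset.mul_sum, ← Finset.sum_sub_distrib,
      ← Finset.sum_add_distrib]
    exact Finset.sum_congr rfl fun j _ => by ring
  simp_rw [h, ha]
  rw [Finset.sum_add_distrib, ← Finset.sum_mul, ha]
  simp only [mul_zero, zero_sub, zero_mul, add_zero]
  rw [Finset.sum_neg_distrib, ← Finset.sum_mul, ← Finset.mul_sum]
  ring

/-- Squared `L²` distances between real functions, not assumed square integrable themselves, are
conditionally negative definite. -/
theorem sum_sum_mul_lintegral_sub_sq_nonpos {Ω ι : Type*} [MeasurableSpace Ω] [Fintype ι]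
    (M : Measure Ω) (X : ι → Ω → ℝ) (hX : ∀ i, Measurable (X i))
    (hfin : ∀ i j, ∫⁻ z, ENNReal.ofReal ((X i z - X j z) ^ 2) ∂M < ∞)
    (a : ι → ℝ) (ha : ∑ i, a i = 0) :
    ∑ i, ∑ j, a i * a j * (∫⁻ z, ENNReal.ofReal ((X i z - X j z) ^ 2) ∂M).toReal ≤ 0 := by
  have hmeas : ∀ i j, AEStronglyMeasurable (fun z => (X i z - X j z) ^ 2) M := fun i j =>
    (((hX i).sub (hX j)).pow_const 2).aestronglyMeasurable
  have hint : ∀ i j, Integrable (fun z => (X i z - X j z) ^ 2) M := fun i j =>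
    ⟨hmeas i j, (hasFiniteIntegral_iff_ofReal (.of_forall fun z => sq_nonneg _)).2 (hfin i j)⟩
  calc ∑ i, ∑ j, a i * a j * (∫⁻ z, ENNReal.ofReal ((X i z - X j z) ^ 2) ∂M).toReal
      = ∑ i, ∑ j, ∫ z, a i * a j * (X i z - X j z) ^ 2 ∂M := by
        refine Finset.sum_congr rfl fun i _ => Finset.sum_congr rfl fun j _ => ?_
        rw [integral_const_mul, integral_eq_lintegral_of_nonneg_ae
          (.of_forall fun z => sq_nonneg _) (hmeas i j)]
    _ = ∫ z, ∑ i, ∑ j, a i * a j * (X i z - X j z) ^ 2 ∂M := by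
        rw [integral_finsetSum _ fun i _ => integrable_finsetSum _ fun j _ =>
          (hint i j).const_mul _]
        refine Finset.sum_congr rfl fun i _ => ?_
        rw [integral_finsetSum _ fun j _ => (hint i j).const_mul _]
    _ ≤ 0 := integral_nonpos fun z =>
        (sum_sum_mul_sub_sq a (fun i => X i z) ha).trans_le
          (mul_nonpos_of_nonpos_of_nonneg (by norm_num) (sq_nonneg _))

/-- The squared sliced Wasserstein distance is finite between measures with densities and finite
second moments, and it is a conditionally negative definite kernel on every set of probability
measures with densities on which it is finite. -/
theorem mainTheorem1 (d : ℕ) :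
    (∀ (P Q : ProbabilityMeasure (EuclideanSpace ℝ (Fin d)))
        (p q : EuclideanSpace ℝ (Fin d) → ℝ≥0∞),
        IsDensity P p → IsDensity Q q →
        MemLp id 2 (P : Measure (EuclideanSpace ℝ (Fin d))) →
        MemLp id 2 (Q : Measure (EuclideanSpace ℝ (Fin d))) →
        slicedWassersteinSq p q < ∞) ∧
      ∀ (S : Set (ProbabilityMeasure (EuclideanSpace ℝ (Fin d))))
        (p : S → EuclideanSpace ℝ (Fin d) → ℝ≥0∞),
        (∀ P : S, IsDensity P.1 (p P)) →
        (∀ P Q : S, slicedWassersteinSq (p P) (p Q) < ∞) →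
        IsCondNegDefKernel fun P Q : S => (slicedWassersteinSq (p P) (p Q)).toReal := by
  refine ⟨fun P Q p q hp hq hP hQ => slicedWassersteinSq_lt_top hp hq hP hQ,
    fun S p hp hfin => ?_⟩
  have hsw := fun P Q : S => slicedWassersteinSq_eq_lintegral_quantile (hp P) (hp Q)
  have hmeas : ∀ P : S,
      Measurable fun z : Metric.sphere (0 : EuclideanSpace ℝ (Fin d)) 1 × ℝ =>
        quantile (sliceLaw (P.1 : Measure (EuclideanSpace ℝ (Fin d))) z.1) z.2 := fun P =>
    measurable_quantile_sliceLaw (P.1 : Measure (EuclideanSpace ℝ (Fin d)))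
  refine ⟨fun P Q => ?_, fun N s a ha => ?_⟩
  · simp only [hsw P Q, hsw Q P, sub_sq_comm]
  · simp only [hsw] at hfin ⊢
    exact sum_sum_mul_lintegral_sub_sq_nonpos _ _ (fun i => hmeas (s i))
      (fun i j => hfin (s i) (s j)) a ha
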